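/- **Theorem (Identifiability of Self-Improvement).** *Setting.* A time-lagged latent causal model (TLCM) has latent states $z=(z_1,\dots,z_k)$ with blocks $z_i\in\mathbb R^{d_i}$, a finite (discrete) action set $A$, deterministic transitions $z^{t+1}=g(z^t,a^t)$, observations $x^t=\varphi(z^t)\in\mathbb R^n$ with $\varphi$ a $C^1$ diffeomorphism onto its image, and a graph $G$ such that $z_i^{t+1}$ is a function of its parents $\mathrm{Pa}(z_i^{t+1})\subseteq\{z_1^t,\dots,z_k^t,a^t\}$. Let $P$ be a probability law of $(z^t,a^t)$ (the seed law; it induces the law of $(x^t,a^t,x^{t+1})$). Put $S_{\rm seed}=\operatorname{supp}P$, and for $U\subseteq\{1,\dots,k\}$ let $S^U_{\rm seed}$ be the support of the law of $(z_U^t,a^t)$. A pair $(z,a)$ is *compositional out-of-support* if $(z,a)\notin S_{\rm seed}$ but $(z_U,a)\in S_{\rm seed}^U$ for some $U$. *Assumptions.* 1. (Identifiable latent blocks.) A second TLCM $(\hat\varphi,\hat g,\hat G)$ with $k$ blocks is $(z,a)$-consistent with the first one: $\hat\varphi$ and $\varphi$ have the same image; $\hat\varphi(\hat g(\hat z,a))=\varphi(g(z,a))$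 whenever $\hat\varphi(\hat z)=\varphi(z)$ and $(z,a)\in S_{\rm seed}$; and there is a permutation $\sigma$ of $\{1,\dots,k\}$ that carries $G$ to $\hat G$ such that, for $v=\varphi^{-1}\circ\hat\varphi$ and for each of the following three relations $R$, the block $v_i(\hat z)$ depends only on the $\hat z_{\sigma(j)}$ with $R(i)\subseteq R(j)$: $R(i)=$ the latent parents of $i$; $R(i)=$ the latent children of $i$; $R(i)=$ the action parents of $i$. Moreover the graphical criterion holds: for every $i$, $$\bigcap_{j\in \mathrm{Ch}(i)}\mathrm{Pa}(j)\ \cap\bigcap_{j\in\mathrm{Pa}(i)}\mathrm{Ch}(j)\ \cap\ C_i=\{i\},$$ where $\mathrm{Pa},\mathrm{Ch}$ are latent parents and children and $C_i$ is the set of children of the action if $a^t\in\mathrm{Pa}(z_i^{t+1})$, and the set of all blocks otherwise. 2. (Verification subset.) $S=S_{\rm src}\cap S_{\rm act}$, where $S_{\rm src}$ is causally insulated ($\mathrm{Pa}(z_i^{t+1})\subseteq\{z_j^t:j\in S_{\rm src}\}\cup\{a^t\}$ for $i\in S_{\rm src}$) and $S_{\rm act}=\{i:a^t\in\mathrm{Pa}(z_i^{t+1})\}$;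 and $[g(z,a)]_S$ depends only on $(z_S,a)$, so that $g_S(z_S,a):=[g(z,a)]_S$ is well defined. 3. (Identifiable action.) For every $a$ the map $w\mapsto g_S(w,a)$ is continuous on $\{w:(w,a)\in S^S_{\rm seed}\}$; if $(w,a_1),(w,a_2)\in S^S_{\rm seed}$ and $g_S(w,a_1)=g_S(w,a_2)$, then $a_1=a_2$; for every $a$ in the action support, $\operatorname{supp}P(z_S\mid a)$ is connected; and any two of these conditional supports intersect. *Training.* Let $\hat S_{\rm src}=\sigma(S_{\rm src})$, let $\hat S$ be its intersection with the action-influenced blocks of $\hat G$, let $\hat z=\hat\varphi^{-1}(x)$ be the encoding of an observation, and write $(w,w')=(\hat z^t_{\hat S},\hat z^{t+1}_{\hat S})$. - For an alphabet $B$ of size $N\ge|A|$ and $\beta>0$, a *solution of the latent-action reconstruction problem* is a minimizer, over inverse models $q(\cdot\mid w,w')$ with values in the probability vectors on $B$, continuous in $(w,w')$, and forward models $f(w,b)$, continuous in $w$, of $$\mathbb E_P\Big[\sum_{b\in B}q(b\mid w,w')\,\|w'-f(w,b)\|^2+\beta\,H\big(q(\cdot\mid w,w')\big)\Big],$$ where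 $H$ is the Shannon entropy. The predicted label is the most likely one. A *decoder* is a map $r:B\to A$ such that $r$ of the predicted label equals $a^t$ for $P$-almost every seed transition. - A *solution of the supervised problem* is a minimizer of $\mathbb E_P[-\log q(a^t\mid w,w')]$ over continuous $q$ with values in the probability vectors on $A$. - A *trained inverse model* $h$ is the predicted label of a solution of the supervised problem, or the decoded predicted label of a solution of the reconstruction problem (for some $N\ge|A|$ and $\beta>0$). *Conclusions.* Say that a transition $(z^*,a^*,g(z^*,a^*))$, with observations $x^*=\varphi(z^*)$ and $x^{*\prime}=\varphi(g(z^*,a^*))$, satisfies the *generation–verification gap* if $(z^*_S,a^*)\in S_{\rm seed}^S$; the pair $(z^*,a^*)$ itself may lie outside $S_{\rm seed}$. Let $(\hat w^*,\hat w^{*\prime})$ be the encoding of $(x^*,x^{*\prime})$ restricted to $\hat S$. (i) There are homeomorphisms $c_i$ with $z_i=c_i(\hat z_{\sigma(i)})$ for all $i$, for every observation in the image; $\hat S_{\rm src}$ is insulated in $\hat G$; and $\hat S=\sigma(S)$. (ii) For every transition with the gap, $a^*$ is the unique action $a$ with $(z_S^*,a)\in S_{\rm seed}^S$ and $g_S(z_S^*,a)=[g(z^*,a^*)]_S$.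 (iii) For all $N\ge|A|$ and $\beta>0$, solutions of the reconstruction problem exist. For every solution there is an injective $v:A\to B$ (a bijection if $N=|A|$) such that for all transitions with the gap $q(v(a^*)\mid\hat w^*,\hat w^{*\prime})=1$, so that the predicted label is $v(a^*)$; and every solution has a decoder. (iv) Solutions of the supervised problem exist. For every trained inverse model $h$ and every transition with the gap, $\hat a^*:=h(\hat w^*,\hat w^{*\prime})$ equals $a^*$, so $(x^*,\hat a^*,x^{*\prime})$ is correctly labeled, i.e. $x^{*\prime}=\varphi(g(z^*,\hat a^*))$. If $(z^*,a^*)\notin S_{\rm seed}$, then it is compositional out-of-support and $S_{\rm seed}\cup\{(z^*,\hat a^*)\}$ is strictly larger than $S_{\rm seed}$. If $P_{\rm test}$ is a probability law of $(z,a)$ for which the gap holds almost surely, then the law $Q$ of the pseudo-labeled pairs $(z,h(\hat w,\hat w'))$ equals $P_{\rm test}$, $\operatorname{supp}(P+Q)=S_{\rm seed}\cup\operatorname{supp}P_{\rm test}$, and this strictly contains $S_{\rm seed}$ whenever $P_{\rm test}(S_{\rm seed}^c)>0$. -/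

import Mathlib

open MeasureTheory Set
open scoped ENNReal

noncomputable section

/-! ### Time-lagged latent causal models -/

/-- Latent states `z = (z_1, …, z_k)`; the block `z_i` is a vector of dimension `d i`. -/
abbrev Latent {k : ℕ} (d : Fin k → ℕ) : Type := ∀ i : Fin k, EuclideanSpace ℝ (Fin (d i))

/-- The sub-vectors `z_S` of a latent state, for a set `S` of block indices. The restriction of
`z` to `S` is `S.restrict z`. -/
abbrev SubLatent {k : ℕ} (d : Fin k → ℕ) (S : Finset (Fin k)) : Type :=
  ∀ i : S, EuclideanSpace ℝ (Fin (d i))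

/-- A (deterministic, Markovian) time-lagged latent causal model with `k` latent blocks, action
set `A` and observations in `ℝⁿ`. -/
structure TLCM (k : ℕ) (d : Fin k → ℕ) (A : Type*) (n : ℕ) where
  /-- the transition map, `z^{t+1} = g (z^t, a^t)` -/
  g : Latent d → A → Latent d
  /-- the observation map, `x^t = φ (z^t)` -/
  φ : Latent d → EuclideanSpace ℝ (Fin n)
  /-- `Gz i j` says that `z_j^t` is a parent of `z_i^{t+1}` -/
  Gz : Fin k → Fin k → Prop
  /-- `Ga i` says that `a^t` is a parent of `z_i^{t+1}` -/
  Ga : Fin k → Prop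
  /-- the observation map is a diffeomorphism onto its image: an injective `C^1` immersion that is
  a homeomorphism onto its image -/
  contDiff_φ : ContDiff ℝ 1 φ
  isEmbedding_φ : Topology.IsEmbedding φ
  immersion_φ : ∀ z, Function.Injective (fderiv ℝ φ z)
  /-- the transition factorizes along the graph: `z_i^{t+1}` is determined by its parents -/
  markov : ∀ i z z' a a', (∀ j, Gz i j → z j = z' j) → (Ga i → a = a') → g z a i = g z' a' i

namespace TLCM

variable {k n : ℕ} {d d' : Fin k → ℕ} {A : Type*}

/-- The encoder `φ⁻¹` (meaningful on the image of `φ`). -/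
def encode (M : TLCM k d A n) : EuclideanSpace ℝ (Fin n) → Latent d := Function.invFun M.φ

/-- The set `T` of blocks is causally insulated from its complement. -/
def IsInsulated (M : TLCM k d A n) (T : Finset (Fin k)) : Prop :=
  ∀ i ∈ T, ∀ j, M.Gz i j → j ∈ T

open Classical in
/-- The action-influenced blocks. -/
def actionInfluenced (M : TLCM k d A n) : Finset (Fin k) := Finset.univ.filter M.Ga

/-- The verification subset attached to an insulated set `T`. -/
def verificationSubset (M : TLCM k d A n) (T : Finset (Fin k)) : Finset (Fin k) :=
  T ∩ M.actionInfluenced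

/-- The next state of the blocks in `S` depends only on their current state and on the action. -/
def IsAutonomous (M : TLCM k d A n) (S : Finset (Fin k)) : Prop :=
  ∀ z z' a, S.restrict z = S.restrict z' → S.restrict (M.g z a) = S.restrict (M.g z' a)

/-- The subset dynamics `g_S (w, a) = [g (z, a)]_S` for any `z` with `z_S = w`. (The value does not
depend on `z` when `S` is autonomous; the definition uses the `z` that vanishes outside `S`.) -/
def subsetDynamics (M : TLCM k d A n) (S : Finset (Fin k)) (w : SubLatent d S) (a : A) :
    SubLatent d S :=
  S.restrict (M.g (fun i => if h : i ∈ S then w ⟨i, h⟩ else 0) a)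

end TLCM

/-! ### Supports -/

section Supports

variable {k n : ℕ} {d : Fin k → ℕ} {A : Type*} [TopologicalSpace A] [MeasurableSpace A]

/-- The support of the marginal law of `(z_S, a)`. The support of the law `P` of `(z, a)` itself is
`P.support`. -/
def marginalSupport (P : Measure (Latent d × A)) (S : Finset (Fin k)) :
    Set (SubLatent d S × A) :=
  (P.map (fun p => (S.restrict p.1, p.2))).support

/-- The restricted state-action pair `(z_S, a)` is on the seed support. -/
def OnSubsetSupport (P : Measure (Latent d × A)) (S : Finset (Fin k)) (z : Latent d) (a : A) :
    Prop :=
  (S.restrict z, a) ∈ marginalSupport P S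

/-- The support of the law of the action. -/
def actionSupport (P : Measure (Latent d × A)) : Set A := (P.map Prod.snd).support

/-- The support of the conditional law of `z_S` given the action `a`. -/
def condSupport (P : Measure (Latent d × A)) (S : Finset (Fin k)) (a : A) :
    Set (SubLatent d S) :=
  ((ProbabilityTheory.cond P {p | p.2 = a}).map (fun p => S.restrict p.1)).support

/-- `(z, a)` is compositional out-of-support: it is outside the support, but some
restriction `(z_U, a)` of it is on the support of the corresponding marginal. -/
def IsCompositionalOOS (P : Measure (Latent d × A)) (z : Latent d) (a : A) : Prop :=
  (z, a) ∉ P.support ∧ ∃ U : Finset (Fin k), OnSubsetSupport P U z a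

/-- Continuity, injectivity, connected conditional supports and support overlap for the subset
dynamics on the seed support. -/
structure SubsetActionConditions (M : TLCM k d A n) (P : Measure (Latent d × A))
    (S : Finset (Fin k)) : Prop where
  continuity : ∀ a, ContinuousOn (fun w => M.subsetDynamics S w a)
    {w | (w, a) ∈ marginalSupport P S}
  injectivity : ∀ w a₁ a₂, (w, a₁) ∈ marginalSupport P S → (w, a₂) ∈ marginalSupport P S →
    M.subsetDynamics S w a₁ = M.subsetDynamics S w a₂ → a₁ = a₂
  connected : ∀ a ∈ actionSupport P, IsConnected (condSupport P S a)
  overlap : ∀ a₁ ∈ actionSupport P, ∀ a₂ ∈ actionSupport P,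
    (condSupport P S a₁ ∩ condSupport P S a₂).Nonempty

end Supports

/-! ### Consistent models and the graphical criterion -/

namespace TLCM

variable {k n : ℕ} {d d' : Fin k → ℕ} {A : Type*}

/-- With `σ` the permutation matching the blocks of the two models, `v = c ∘ (permutation by σ)`
where `c` is `G`-preserving: `c_i` depends only on those coordinates `j` for which row `i` of `G`
is contained in row `j` of `G`. -/
def IsGraphPreserving {ι : Type*} (G : Fin k → ι → Prop) (σ : Equiv.Perm (Fin k))
    (v : Latent d' → Latent d) : Prop :=
  ∀ i y y', (∀ j, (∀ l, G i l → G j l) → y (σ j) = y' (σ j)) → v y i = v y' i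

/-- The learned model `M'` is `(z, a)`-consistent with the ground truth `M` on the seed data, `σ`
being the matching of the blocks: both models generate the same observations and, on the seed
support, the same transitions; the learned graph is the true graph relabeled by `σ`; and the change
of latent coordinates `v = φ⁻¹ ∘ φ'` is, up to `σ`, preserving for the action graph, for the
latent graph and for the transposed latent graph. -/
structure IsConsistent [TopologicalSpace A] [MeasurableSpace A] (M : TLCM k d A n)
    (M' : TLCM k d' A n) (P : Measure (Latent d × A)) (σ : Equiv.Perm (Fin k)) : Prop where
  range_eq : range M'.φ = range M.φ
  transition_eq : ∀ z y a, (z, a) ∈ P.support → M'.φ y = M.φ z →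
    M'.φ (M'.g y a) = M.φ (M.g z a)
  graph_z : ∀ i j, M'.Gz (σ i) (σ j) ↔ M.Gz i j
  graph_a : ∀ i, M'.Ga (σ i) ↔ M.Ga i
  preserving_a : IsGraphPreserving (fun i (_ : Unit) => M.Ga i) σ (fun y => M.encode (M'.φ y))
  preserving_z : IsGraphPreserving M.Gz σ (fun y => M.encode (M'.φ y))
  preserving_zT : IsGraphPreserving (fun i j => M.Gz j i) σ (fun y => M.encode (M'.φ y))

/-- The graphical criterion: for every `i`, the intersection of the parent sets of all children of
`i`, of the children sets of all latent parents of `i`, and (if the action is a parent of `i`) of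
the set of children of the action, is `{i}`. -/
def GraphicalCriterion (M : TLCM k d A n) : Prop :=
  ∀ i, (⋂ j ∈ {j | M.Gz j i}, {l | M.Gz j l}) ∩ (⋂ j ∈ {j | M.Gz i j}, {l | M.Gz l j}) ∩
    {l | M.Ga i → M.Ga l} = {i}

end TLCM

/-! ### Inverse models trained on the encoded seed transitions -/

section Training

theorem exists_argmax {B : Type*} [Fintype B] (p : stdSimplex ℝ B) :
    ∃ b, ∀ b', (p : B → ℝ) b' ≤ (p : B → ℝ) b := by
  have : Nonempty B := by
    by_contra h
    rw [not_nonempty_iff] at h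
    have := p.2.2
    simp at this
  exact Finite.exists_max _

/-- The most likely label under a probability vector. -/
def predictedLabel {B : Type*} [Fintype B] (p : stdSimplex ℝ B) : B := (exists_argmax p).choose

variable {k n : ℕ} {d d' : Fin k → ℕ} {A : Type*}

/-- The pair `(ẑ_S^t, ẑ_S^{t+1})` obtained by encoding two consecutive observations with the learned
model `M'` and keeping the blocks in `S`. -/
def TLCM.encodePair (M' : TLCM k d' A n) (S : Finset (Fin k)) (x x' : EuclideanSpace ℝ (Fin n)) :
    SubLatent d' S × SubLatent d' S :=
  (S.restrict (M'.encode x), S.restrict (M'.encode x'))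

/-- The encoded subset transition of the true transition that starts in state `z` with action `a`,
as observed through `x^t = φ z` and `x^{t+1} = φ (g (z, a))`. -/
def encodedTransition (M : TLCM k d A n) (M' : TLCM k d' A n) (S : Finset (Fin k))
    (p : Latent d × A) : SubLatent d' S × SubLatent d' S :=
  M'.encodePair S (M.φ p.1) (M.φ (M.g p.1 p.2))

/-- A latent action model on `SubLatent d S` with latent action alphabet `B`: a continuous
stochastic inverse dynamics model `q(b | w, w')`, and a forward dynamics model `f(w, b)` that is
continuous in `w`. -/
structure LatentActionModel (d : Fin k → ℕ) (S : Finset (Fin k)) (B : Type*) [Fintype B] where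
  idm : C(SubLatent d S × SubLatent d S, stdSimplex ℝ B)
  fdm : B → C(SubLatent d S, SubLatent d S)

/-- The entropy-regularized reconstruction loss of one transition `(w, w')`:
`∑_b q(b | w, w') ‖w' - f(w, b)‖² + β H(q(· | w, w'))`. -/
def LatentActionModel.loss {S : Finset (Fin k)} {B : Type*} [Fintype B]
    (m : LatentActionModel d S B) (β : ℝ) (p : SubLatent d S × SubLatent d S) : ℝ :=
  ∑ b, (m.idm p : B → ℝ) b * ∑ i, ‖p.2 i - m.fdm b p.1 i‖ ^ 2
    + β * ∑ b, Real.negMulLog ((m.idm p : B → ℝ) b)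

/-- The negative log-likelihood `-log r ∈ [0, ∞]` of a probability `r ∈ [0, 1]`. -/
def negLogLikelihood (r : ℝ) : ℝ≥0∞ := if r ≤ 0 then ⊤ else ENNReal.ofReal (-Real.log r)

variable [TopologicalSpace A] [MeasurableSpace A]

/-- `m` solves the latent-action reconstruction problem on the encoded (unlabeled) seed transitions:
it minimizes the expected entropy-regularized reconstruction loss. -/
def IsReconstructionSolution (M : TLCM k d A n) (M' : TLCM k d' A n) (P : Measure (Latent d × A))
    (S : Finset (Fin k)) {B : Type*} [Fintype B] (β : ℝ) (m : LatentActionModel d' S B) : Prop :=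
  ∀ m₁ : LatentActionModel d' S B,
    ∫⁻ p, ENNReal.ofReal (m.loss β (encodedTransition M M' S p)) ∂P ≤
      ∫⁻ p, ENNReal.ofReal (m₁.loss β (encodedTransition M M' S p)) ∂P

/-- `q` solves the supervised inverse dynamics problem on the encoded, action-labeled seed
transitions: it minimizes the expected cross-entropy among continuous stochastic inverse models. -/
def IsSupervisedSolution [Fintype A] (M : TLCM k d A n) (M' : TLCM k d' A n)
    (P : Measure (Latent d × A)) (S : Finset (Fin k))
    (q : C(SubLatent d' S × SubLatent d' S, stdSimplex ℝ A)) : Prop :=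
  ∀ q₁ : C(SubLatent d' S × SubLatent d' S, stdSimplex ℝ A),
    ∫⁻ p, negLogLikelihood ((q (encodedTransition M M' S p) : A → ℝ) p.2) ∂P ≤
      ∫⁻ p, negLogLikelihood ((q₁ (encodedTransition M M' S p) : A → ℝ) p.2) ∂P

/-- `r` decodes the latent action labels of `m` into actions, correctly on the labeled seed data. -/
def IsLabelDecoder (M : TLCM k d A n) (M' : TLCM k d' A n) (P : Measure (Latent d × A))
    (S : Finset (Fin k)) {B : Type*} [Fintype B] (m : LatentActionModel d' S B) (r : B → A) :
    Prop :=
  ∀ᵐ p ∂P, r (predictedLabel (m.idm (encodedTransition M M' S p))) = p.2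

/-- `h` is an inverse dynamics model trained on the labeled seed data: either the label predicted by
a solution of the supervised problem, or the label predicted by a solution of the latent-action
reconstruction problem, decoded by means of the labeled data. -/
def IsTrainedInverseModel [Fintype A] (M : TLCM k d A n) (M' : TLCM k d' A n)
    (P : Measure (Latent d × A)) (S : Finset (Fin k))
    (h : SubLatent d' S × SubLatent d' S → A) : Prop :=
  (∃ q, IsSupervisedSolution M M' P S q ∧ ∀ p, h p = predictedLabel (q p)) ∨
  (∃ (N : ℕ) (β : ℝ) (m : LatentActionModel d' S (Fin N)) (r : Fin N → A),
    Fintype.card A ≤ N ∧ 0 < β ∧ IsReconstructionSolution M M' P S β m ∧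
      IsLabelDecoder M M' P S m r ∧ ∀ p, h p = r (predictedLabel (m.idm p)))

end Training

end

/-!
The encoder of the learned model and that of the true model differ by a homeomorphism of latent
spaces whose `i`-th block depends only on blocks in each of three sets. A function that depends only
on `J₁` and only on `J₂` depends only on `J₁ ∩ J₂` (`eq_of_dependsOn_inter`), and the graphical
criterion says that the three sets intersect in the block matched with `i`. A homeomorphism of
products of this form acts block by block (`Homeomorph.exists_coordinatewise`). So the learned
sub-vectors on the verification subset are a homeomorphic copy of the true ones.

In these coordinates the seed transitions with action `a` lie on the graph of a continuous map `F a`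
over a closed connected set `K a`; the graphs of different actions are disjoint, by injectivity of
the subset dynamics, while the sets `K a` intersect pairwise (`IsIdentifiableEncoding`). Disjoint
closed sets are separated by a partition of unity, so a continuous inverse model that is certain of
the label exists, and with the forward model `F` both training problems attain loss zero
(`IsIdentifiableEncoding.exists_classifier`, `IsIdentifiableEncoding.exists_model`). Hence every
solution has loss zero almost surely, and by continuity on the whole support of the marginal law of
`(z_S, a)`, which contains every transition with the generation–verification gap. For the supervised
problem this says that the label is correct. For the reconstruction problem, zero entropy makes the
inverse model deterministic, connectedness of `K a` makes its label depend on `a` alone, and a label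
shared by two actions would predict the same next state from a common point of the two sets, against
injectivity (`IsIdentifiableEncoding.reconstructionSolution_apply`).

A decoder that is correct almost surely on the seed data is correct on every label that belongs to
an action of positive probability, hence on all transitions with the gap; pseudo-labeling therefore
reproduces the test law.
-/

/-! ### Maps between product spaces with prescribed dependencies -/

/-- A function on a product that depends only on the coordinates in `J₁`, and also only on those in
`J₂`, depends only on the coordinates in `J₁ ∩ J₂`. -/
theorem eq_of_dependsOn_inter {ι β : Type*} {Y : ι → Type*} {f : (∀ i, Y i) → β} {J₁ J₂ : Set ι}
    (h₁ : ∀ y y', (∀ j ∈ J₁, y j = y' j) → f y = f y')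
    (h₂ : ∀ y y', (∀ j ∈ J₂, y j = y' j) → f y = f y')
    (y y' : ∀ i, Y i) (h : ∀ j ∈ J₁ ∩ J₂, y j = y' j) : f y = f y' := by
  classical
  -- `y` on `J₁` and `y'` elsewhere
  let z : ∀ i, Y i := fun j => if j ∈ J₁ then y j else y' j
  have hyz : f y = f z := h₁ _ _ fun j hj => by simp [z, hj]
  have hzy : f z = f y' := h₂ _ _ fun j hj => by
    by_cases hj₁ : j ∈ J₁
    · simpa [z, hj₁] using h j ⟨hj₁, hj⟩
    · simp [z, hj₁]
  exact hyz.trans hzy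

/-- If the coordinate `i` of a homeomorphism between products depends only on the coordinate `σ i`
of the argument, for a permutation `σ`, then the homeomorphism acts coordinate by coordinate through
homeomorphisms. -/
theorem Homeomorph.exists_coordinatewise {ι : Type*} {X Y : ι → Type*}
    [∀ i, TopologicalSpace (X i)] [∀ i, TopologicalSpace (Y i)] [∀ i, Nonempty (X i)]
    [∀ i, Nonempty (Y i)] (v : (∀ i, Y i) ≃ₜ ∀ i, X i) (σ : Equiv.Perm ι)
    (hv : ∀ i y y', y (σ i) = y' (σ i) → v y i = v y' i) :
    ∃ c : ∀ i, Y (σ i) ≃ₜ X i, ∀ y i, v y i = c i (y (σ i)) := by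
  classical
  let x₀ : ∀ i, X i := fun i => Classical.arbitrary _
  let y₀ : ∀ i, Y i := fun i => Classical.arbitrary _
  -- coordinate `i` of the image determines coordinate `σ i` of the argument
  have hinj : ∀ i y y', v y i = v y' i → y (σ i) = y' (σ i) := by
    intro i y y' h
    have : Function.update y (σ i) (y' (σ i)) = y := by
      apply v.injective
      funext j
      by_cases hj : j = i
      · subst hj
        rw [h]
        exact hv _ _ _ (by simp)
      · exact hv _ _ _ (by simp [hj])
    rw [← this]
    simp
  refine ⟨fun i =>
    { toFun := fun t => v (Function.update y₀ (σ i) t) i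
      invFun := fun u => v.symm (Function.update x₀ i u) (σ i)
      left_inv := fun t => ?_
      right_inv := fun u => ?_
      continuous_toFun := ?_
      continuous_invFun := ?_ }, fun y i => ?_⟩
  · have := hinj i (v.symm (Function.update x₀ i (v (Function.update y₀ (σ i) t) i)))
      (Function.update y₀ (σ i) t) (by simp)
    simpa using this
  · have := hv i (Function.update y₀ (σ i) (v.symm (Function.update x₀ i u) (σ i)))
      (v.symm (Function.update x₀ i u)) (by simp)
    simpa using this
  · exact (continuous_apply i).comp (v.continuous.comp (continuous_const.update _ continuous_id))
  · exact (continuous_apply (σ i)).comp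
      (v.symm.continuous.comp (continuous_const.update _ continuous_id))
  · exact hv _ _ _ (by simp)

/-! ### Identification of the latent blocks -/

namespace TLCM

variable {k n : ℕ} {d d' : Fin k → ℕ} {A : Type*}

theorem encode_φ (M : TLCM k d A n) (z : Latent d) : M.encode (M.φ z) = z :=
  Function.leftInverse_invFun M.isEmbedding_φ.injective z

theorem φ_encode (M : TLCM k d A n) {x : EuclideanSpace ℝ (Fin n)} (hx : x ∈ range M.φ) :
    M.φ (M.encode x) = x :=
  Function.invFun_eq hx

/-- The change of latent coordinates between two models with the same observations. -/
noncomputable def latentChange (M : TLCM k d A n) (M' : TLCM k d' A n)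
    (h : range M'.φ = range M.φ) :
    Latent d' ≃ₜ Latent d where
  toFun y := M.encode (M'.φ y)
  invFun z := M'.encode (M.φ z)
  left_inv y := by
    beta_reduce
    rw [M.φ_encode (h ▸ mem_range_self y), M'.encode_φ]
  right_inv z := by
    beta_reduce
    rw [M'.φ_encode (h ▸ mem_range_self z), M.encode_φ]
  continuous_toFun := by
    rw [M.isEmbedding_φ.continuous_iff]
    convert M'.isEmbedding_φ.continuous using 1
    exact funext fun y => M.φ_encode (h ▸ mem_range_self y)
  continuous_invFun := by
    rw [M'.isEmbedding_φ.continuous_iff]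
    convert M.isEmbedding_φ.continuous using 1
    exact funext fun z => M'.φ_encode (h ▸ mem_range_self z)

/-- Under the graphical criterion, the blocks on which all three preservation properties let the
`i`-th latent block depend reduce to the block matched with `i`; hence the two encoders agree up to
the matching and block-wise homeomorphisms. -/
theorem IsConsistent.exists_blockwise [TopologicalSpace A] [MeasurableSpace A] {M : TLCM k d A n}
    {M' : TLCM k d' A n} {P : Measure (Latent d × A)} {σ : Equiv.Perm (Fin k)}
    (hcons : M.IsConsistent M' P σ) (hgraph : M.GraphicalCriterion) :
    ∃ c : ∀ i, EuclideanSpace ℝ (Fin (d' (σ i))) ≃ₜ EuclideanSpace ℝ (Fin (d i)),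
      ∀ x ∈ range M.φ, ∀ i, M.encode x i = c i (M'.encode x (σ i)) := by
  have key : ∀ i y y', y (σ i) = y' (σ i) →
      M.latentChange M' hcons.range_eq y i = M.latentChange M' hcons.range_eq y' i := by
    intro i y y' hy
    let Jz : Set (Fin k) := {j | ∀ l, M.Gz i l → M.Gz (σ.symm j) l}
    let Jt : Set (Fin k) := {j | ∀ l, M.Gz l i → M.Gz l (σ.symm j)}
    let Ja : Set (Fin k) := {j | M.Ga i → M.Ga (σ.symm j)}
    refine eq_of_dependsOn_inter (f := fun y => M.encode (M'.φ y) i) (J₁ := Jt ∩ Jz) (J₂ := Ja)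
      (eq_of_dependsOn_inter ?_ ?_) ?_ y y' ?_
    · exact fun y y' h => hcons.preserving_zT i y y' fun j hj => h _ (by simpa [Jt] using hj)
    · exact fun y y' h => hcons.preserving_z i y y' fun j hj => h _ (by simpa [Jz] using hj)
    · exact fun y y' h => hcons.preserving_a i y y' fun j hj => h _ (by simpa [Ja] using hj)
    · rintro j ⟨⟨ht, hz⟩, ha⟩
      have : σ.symm j ∈ ({i} : Set (Fin k)) := by
        rw [← hgraph i]
        refine ⟨⟨?_, ?_⟩, ha⟩
        · exact mem_iInter₂.2 ht
        · exact mem_iInter₂.2 hz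
      rw [mem_singleton_iff, Equiv.symm_apply_eq] at this
      exact this ▸ hy
  obtain ⟨c, hc⟩ := (M.latentChange M' hcons.range_eq).exists_coordinatewise σ key
  refine ⟨c, fun x hx i => ?_⟩
  rw [← hc]
  change _ = M.encode (M'.φ (M'.encode x)) i
  rw [M'.φ_encode (hcons.range_eq ▸ hx)]

theorem IsConsistent.isInsulated_map [TopologicalSpace A] [MeasurableSpace A] {M : TLCM k d A n}
    {M' : TLCM k d' A n} {P : Measure (Latent d × A)} {σ : Equiv.Perm (Fin k)}
    (hcons : M.IsConsistent M' P σ) {T : Finset (Fin k)} (hT : M.IsInsulated T) :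
    M'.IsInsulated (T.map σ.toEmbedding) := by
  intro i hi j hij
  obtain ⟨i, rfl⟩ := σ.surjective i
  obtain ⟨j, rfl⟩ := σ.surjective j
  have hi' : i ∈ T := by simpa using hi
  simpa using hT i hi' j ((hcons.graph_z i j).1 hij)

theorem IsConsistent.verificationSubset_map [TopologicalSpace A] [MeasurableSpace A]
    {M : TLCM k d A n} {M' : TLCM k d' A n} {P : Measure (Latent d × A)}
    {σ : Equiv.Perm (Fin k)} (hcons : M.IsConsistent M' P σ) (T : Finset (Fin k)) :
    M'.verificationSubset (T.map σ.toEmbedding) =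
      (M.verificationSubset T).map σ.toEmbedding := by
  ext i
  obtain ⟨i, rfl⟩ := σ.surjective i
  simp [verificationSubset, actionInfluenced, hcons.graph_a]

/-- For an autonomous set, the choice of zero outside `S` in `subsetDynamics` is immaterial. -/
theorem IsAutonomous.subsetDynamics_restrict {M : TLCM k d A n} {S : Finset (Fin k)}
    (h : M.IsAutonomous S) (z : Latent d) (a : A) :
    M.subsetDynamics S (S.restrict z) a = S.restrict (M.g z a) := by
  refine h _ _ a ?_
  funext i
  simp [Finset.restrict]

/-- The block-wise homeomorphisms assemble to a homeomorphism between the sub-vectors of the true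
latents on `S` and those of the learned latents on the relabeled set. -/
theorem exists_subLatent_homeomorph {M : TLCM k d A n} {M' : TLCM k d' A n}
    {σ : Equiv.Perm (Fin k)}
    (c : ∀ i, EuclideanSpace ℝ (Fin (d' (σ i))) ≃ₜ EuclideanSpace ℝ (Fin (d i)))
    (hc : ∀ x ∈ range M.φ, ∀ i, M.encode x i = c i (M'.encode x (σ i))) (S : Finset (Fin k)) :
    ∃ e : SubLatent d S ≃ₜ SubLatent d' (S.map σ.toEmbedding),
      ∀ z, (S.map σ.toEmbedding).restrict (M'.encode (M.φ z)) = e (S.restrict z) := by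
  let τ : S ≃ (S.map σ.toEmbedding : Finset (Fin k)) := 
    σ.subtypeEquiv fun i => by simp
  let e : SubLatent d S ≃ₜ SubLatent d' (S.map σ.toEmbedding) :=
    Homeomorph.piCongr (Y₁ := fun i : S => EuclideanSpace ℝ (Fin (d i)))
      (Y₂ := fun i : (S.map σ.toEmbedding : Finset (Fin k)) => EuclideanSpace ℝ (Fin (d' i)))
      τ fun i => (c i).symm
  refine ⟨e, fun z => ?_⟩
  funext j
  obtain ⟨i, rfl⟩ := τ.surjective j
  have h : e (S.restrict z) (τ i) = (c i).symm (z i) :=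
    Equiv.piCongr_apply_apply (W := fun i : S => EuclideanSpace ℝ (Fin (d i)))
      (Z := fun i : (S.map σ.toEmbedding : Finset (Fin k)) => EuclideanSpace ℝ (Fin (d' i)))
      τ (fun i => (c i).symm.toEquiv) (S.restrict z) i
  have h' : M'.encode (M.φ z) (σ i) = (c i).symm (z i) := by
    rw [Homeomorph.eq_symm_apply, ← hc (M.φ z) (mem_range_self z) i, M.encode_φ]
  exact h'.trans h.symm

end TLCM

/-! ### Classifiers with values in the simplex -/

section Classifier

variable {B : Type*} [Fintype B]

/-- A probability vector that gives mass one to a label gives mass zero to the others. -/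
theorem stdSimplex_apply_eq_zero {p : stdSimplex ℝ B} {b b' : B} (hb : (p : B → ℝ) b = 1)
    (h : b' ≠ b) : (p : B → ℝ) b' = 0 := by
  classical
  have hsum : ∑ x ∈ Finset.univ.erase b, (p : B → ℝ) x = 0 := by
    have h₁ := Finset.add_sum_erase Finset.univ (p : B → ℝ) (Finset.mem_univ b)
    have h₂ : ∑ x, (p : B → ℝ) x = 1 := p.2.2
    linarith
  exact (Finset.sum_eq_zero_iff_of_nonneg fun x _ => p.2.1 x).1 hsum b' (by simp [h])

theorem predictedLabel_eq {p : stdSimplex ℝ B} {b : B} (hb : (p : B → ℝ) b = 1) :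
    predictedLabel p = b := by
  by_contra h
  have h₁ : (p : B → ℝ) b ≤ (p : B → ℝ) (predictedLabel p) := (exists_argmax p).choose_spec b
  rw [hb, stdSimplex_apply_eq_zero hb h] at h₁
  linarith

/-- Finitely many disjoint closed sets can be separated by a continuous classifier: a partition of
unity subordinate to the complements of the unions of the other sets. -/
theorem exists_continuous_classifier {X : Type*} [TopologicalSpace X] [NormalSpace X]
    [Nonempty B] (E : B → Set X) (hE : ∀ b, IsClosed (E b))
    (hdisj : ∀ x b b', x ∈ E b → x ∈ E b' → b = b') :
    ∃ q : C(X, stdSimplex ℝ B), ∀ b, ∀ x ∈ E b, (q x : B → ℝ) b = 1 := by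
  classical
  let U : B → Set X := fun b => (⋃ b' : {b' // b' ≠ b}, E b')ᶜ
  have hUo : ∀ b, IsOpen (U b) := fun b =>
    (isClosed_iUnion_of_finite fun b' : {b' // b' ≠ b} => hE b').isOpen_compl
  have hU : (univ : Set X) ⊆ ⋃ b, U b := by
    intro x _
    by_cases hx : ∃ b, x ∈ E b
    · obtain ⟨b, hb⟩ := hx
      refine mem_iUnion.2 ⟨b, fun h => ?_⟩
      obtain ⟨⟨b', hb'⟩, hxb'⟩ := mem_iUnion.1 h
      exact hb' (hdisj x b' b hxb' hb)
    · refine mem_iUnion.2 ⟨Classical.arbitrary B, fun h => ?_⟩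
      obtain ⟨b', hxb'⟩ := mem_iUnion.1 h
      exact hx ⟨b', hxb'⟩
  obtain ⟨f, hf⟩ := PartitionOfUnity.exists_isSubordinate_of_locallyFinite isClosed_univ U hUo
    (locallyFinite_of_finite U) hU
  have hsum : ∀ x, ∑ b, f b x = 1 := fun x => by
    rw [← finsum_eq_sum_of_fintype]
    exact f.sum_eq_one (mem_univ x)
  refine ⟨⟨fun x => ⟨fun b => f b x, fun b => f.nonneg b x, hsum x⟩, ?_⟩, fun b x hx => ?_⟩
  · exact Continuous.subtype_mk (continuous_pi fun b => (f b).continuous) _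
  · change f b x = 1
    rw [← hsum x, eq_comm]
    refine Finset.sum_eq_single b (fun b' _ hb' => ?_) (by simp)
    by_contra hne
    have : x ∈ U b' := hf b' (subset_tsupport _ hne)
    exact this (mem_iUnion.2 ⟨⟨b, hb'.symm⟩, hx⟩)

/-- An injective relabeling of finitely many elements into a large enough alphabet extends to
all of the type. -/
theorem exists_injective_extension {A : Type*} [Fintype A] {B : Type*} [Fintype B]
    (hcard : Fintype.card A ≤ Fintype.card B) (s : Set A) (u : A → B) (hu : InjOn u s) :
    ∃ v : A → B, Function.Injective v ∧ EqOn v u s := by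
  classical
  obtain ⟨t, hst, ht⟩ := Finset.exists_superset_card_eq (s := s.toFinset.image u)
    (n := Fintype.card A) (Finset.card_image_le.trans (Finset.card_le_univ _)) hcard
  obtain ⟨g, hg⟩ := MapsTo.exists_equiv_extend_of_card_eq (s := s) (f := u) ht.symm
    (fun a ha => hst (Finset.mem_image_of_mem u (by simpa using ha))) hu
  exact ⟨fun a => g a, Subtype.val_injective.comp g.injective, hg⟩

end Classifier

/-! ### The encoded transitions of the seed law -/

section Identifiable

variable {k n : ℕ} {d d' : Fin k → ℕ} {A : Type*} [MeasurableSpace A]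

/-- The encoded transitions on `S` identify the action: for each action `a`, they start in a closed
preconnected set `K a` and follow a continuous map `F a`, two actions agree at no common starting
point, and the sets `K a` intersect pairwise unless empty. The last two fields say that the pairs
`(w, F a w)` with `w ∈ K a` carry the seed law and lie in its support. -/
structure IsIdentifiableEncoding (M : TLCM k d A n) (M' : TLCM k d' A n)
    (P : Measure (Latent d × A)) (S : Finset (Fin k)) (K : A → Set (SubLatent d' S))
    (F : A → C(SubLatent d' S, SubLatent d' S)) : Prop where
  isClosed : ∀ a, IsClosed (K a)
  isPreconnected : ∀ a, IsPreconnected (K a)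
  overlap : ∀ a b, (K a).Nonempty → (K b).Nonempty → (K a ∩ K b).Nonempty
  injective : ∀ w a b, w ∈ K a → w ∈ K b → F a w = F b w → a = b
  aemeasurable : AEMeasurable (encodedTransition M M' S) P
  ae_mem : ∀ᵐ p ∂P, ∃ w ∈ K p.2, encodedTransition M M' S p = (w, F p.2 w)
  extend : ∀ C : A → Set (SubLatent d' S × SubLatent d' S), (∀ a, IsClosed (C a)) →
    (∀ᵐ p ∂P, encodedTransition M M' S p ∈ C p.2) → ∀ a, ∀ w ∈ K a, (w, F a w) ∈ C a

theorem isClosed_graphOver {X Y : Type*} [TopologicalSpace X] [TopologicalSpace Y] [T2Space Y]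
    {K : Set X} (hK : IsClosed K) (F : C(X, Y)) : IsClosed {p : X × Y | p.1 ∈ K ∧ p.2 = F p.1} :=
  (hK.preimage continuous_fst).inter
    (isClosed_eq continuous_snd (F.continuous.comp continuous_fst))

variable {M : TLCM k d A n} {M' : TLCM k d' A n} {P : Measure (Latent d × A)}
  {S : Finset (Fin k)} {K : A → Set (SubLatent d' S)} {F : A → C(SubLatent d' S, SubLatent d' S)}

/-- For every labeling `v` of the actions, some continuous classifier puts all its mass on the label
of the action. -/
theorem IsIdentifiableEncoding.exists_classifier [Finite A]
    (H : IsIdentifiableEncoding M M' P S K F) {B : Type*} [Fintype B] [Nonempty B] (v : A → B) :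
    ∃ q : C(SubLatent d' S × SubLatent d' S, stdSimplex ℝ B),
      ∀ a, ∀ w ∈ K a, (q (w, F a w) : B → ℝ) (v a) = 1 := by
  obtain ⟨q, hq⟩ := exists_continuous_classifier
    (fun b => ⋃ a : {a // v a = b}, {p : SubLatent d' S × SubLatent d' S | p.1 ∈ K a ∧
      p.2 = F a p.1})
    (fun b => isClosed_iUnion_of_finite fun a => isClosed_graphOver (H.isClosed a) (F a)) (by
      intro x b b' h h'
      obtain ⟨⟨a, rfl⟩, ha, hxa⟩ := mem_iUnion.1 h
      obtain ⟨⟨a', rfl⟩, ha', hxa'⟩ := mem_iUnion.1 h'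
      rw [H.injective x.1 a a' ha ha' (hxa.symm.trans hxa')])
  exact ⟨q, fun a w hw => hq (v a) _ (mem_iUnion.2 ⟨⟨a, rfl⟩, hw, rfl⟩)⟩

/-! ### The supervised problem -/

theorem negLogLikelihood_eq_zero {r : ℝ} : negLogLikelihood r = 0 ↔ 1 ≤ r := by
  unfold negLogLikelihood
  split_ifs with h
  · simp only [ENNReal.top_ne_zero, false_iff]
    linarith
  · rw [ENNReal.ofReal_eq_zero, neg_nonpos, Real.log_nonneg_iff (by linarith)]

theorem measurable_negLogLikelihood : Measurable negLogLikelihood :=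
  Measurable.ite measurableSet_Iic measurable_const
    (ENNReal.measurable_ofReal.comp Real.measurable_log.neg)

theorem stdSimplex_apply_le_one {B : Type*} [Fintype B] (p : stdSimplex ℝ B) (b : B) :
    (p : B → ℝ) b ≤ 1 := by
  rw [← show ∑ x, (p : B → ℝ) x = 1 from p.2.2]
  exact Finset.single_le_sum (fun x _ => p.2.1 x) (Finset.mem_univ b)

/-- The supervised loss is measurable along the seed law, since there are finitely many actions. -/
theorem IsIdentifiableEncoding.aemeasurable_likelihood [Fintype A] [MeasurableSingletonClass A]
    (H : IsIdentifiableEncoding M M' P S K F)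
    (q : C(SubLatent d' S × SubLatent d' S, stdSimplex ℝ A)) :
    AEMeasurable (fun p => negLogLikelihood ((q (encodedTransition M M' S p) : A → ℝ) p.2)) P := by
  refine measurable_negLogLikelihood.comp_aemeasurable ?_
  have h : Measurable fun x : (SubLatent d' S × SubLatent d' S) × A => (q x.1 : A → ℝ) x.2 :=
    measurable_from_prod_countable_left fun a =>
      ((continuous_apply a).comp (continuous_subtype_val.comp q.continuous)).measurable
  exact h.comp_aemeasurable (H.aemeasurable.prodMk measurable_snd.aemeasurable)

theorem IsIdentifiableEncoding.supervisedLoss_eq_zero [Fintype A]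
    (H : IsIdentifiableEncoding M M' P S K F)
    {q : C(SubLatent d' S × SubLatent d' S, stdSimplex ℝ A)}
    (hq : ∀ a, ∀ w ∈ K a, (q (w, F a w) : A → ℝ) a = 1) :
    ∫⁻ p, negLogLikelihood ((q (encodedTransition M M' S p) : A → ℝ) p.2) ∂P = 0 := by
  rw [lintegral_congr_ae (g := 0) ?_]
  · simp
  filter_upwards [H.ae_mem] with p ⟨w, hw, hp⟩
  rw [hp, hq _ w hw]
  exact negLogLikelihood_eq_zero.2 le_rfl

theorem IsIdentifiableEncoding.exists_isSupervisedSolution [TopologicalSpace A] [Fintype A]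
    [Nonempty A] (H : IsIdentifiableEncoding M M' P S K F) :
    ∃ q, IsSupervisedSolution M M' P S q := by
  obtain ⟨q, hq⟩ := H.exists_classifier id
  exact ⟨q, fun q₁ => (H.supervisedLoss_eq_zero hq).trans_le bot_le⟩

/-- The minimum of the supervised loss is zero, so that a solution gives almost surely mass one to
the action; by continuity it does so on the whole support. -/
theorem IsIdentifiableEncoding.supervisedSolution_apply [TopologicalSpace A] [Fintype A]
    [Nonempty A] [MeasurableSingletonClass A] (H : IsIdentifiableEncoding M M' P S K F)
    {q : C(SubLatent d' S × SubLatent d' S, stdSimplex ℝ A)}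
    (hq : IsSupervisedSolution M M' P S q) (a : A) (w : SubLatent d' S) (hw : w ∈ K a) :
    (q (w, F a w) : A → ℝ) a = 1 := by
  obtain ⟨q₀, hq₀⟩ := H.exists_classifier id
  have h0 := le_bot_iff.1 ((hq q₀).trans_eq (H.supervisedLoss_eq_zero hq₀))
  rw [bot_eq_zero, lintegral_eq_zero_iff' (H.aemeasurable_likelihood q)] at h0
  refine H.extend (fun a => {x | (q x : A → ℝ) a = 1}) (fun a => ?_) ?_ a w hw
  · exact isClosed_eq ((continuous_apply a).comp (continuous_subtype_val.comp q.continuous))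
      continuous_const
  · filter_upwards [h0] with p hp
    exact le_antisymm (stdSimplex_apply_le_one _ _) (negLogLikelihood_eq_zero.1 hp)

/-! ### The reconstruction problem -/

namespace LatentActionModel

variable {B : Type*} [Fintype B] (m : LatentActionModel d' S B) (β : ℝ)

theorem continuous_loss : Continuous (m.loss β) := by
  have hq : ∀ b, Continuous fun p => (m.idm p : B → ℝ) b := fun b =>
    (continuous_apply b).comp (continuous_subtype_val.comp m.idm.continuous)
  unfold loss
  refine (continuous_finsetSum _ fun b _ => (hq b).mul
    (continuous_finsetSum _ fun i _ => (Continuous.norm ?_).pow 2)).add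
    (continuous_const.mul (continuous_finsetSum _ fun b _ =>
      Real.continuous_negMulLog.comp (hq b)))
  exact ((continuous_apply i).comp continuous_snd).sub
    ((continuous_apply i).comp ((m.fdm b).continuous.comp continuous_fst))

/-- A deterministic inverse model whose label reconstructs the next state has loss zero. -/
theorem loss_eq_zero {p : SubLatent d' S × SubLatent d' S} {b : B}
    (hb : (m.idm p : B → ℝ) b = 1) (hf : m.fdm b p.1 = p.2) : m.loss β p = 0 := by
  have h : ∀ b', b' ≠ b → (m.idm p : B → ℝ) b' = 0 := fun b' => stdSimplex_apply_eq_zero hb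
  unfold loss
  rw [Finset.sum_eq_zero, Finset.sum_eq_zero]
  · simp
  all_goals
    intro b' _
    by_cases hb' : b' = b
    · subst hb'
      simp [hb, hf]
    · simp [h b' hb']

variable {β}

theorem loss_nonneg (hβ : 0 < β) (p : SubLatent d' S × SubLatent d' S) : 0 ≤ m.loss β p := by
  refine add_nonneg (Finset.sum_nonneg fun b _ => mul_nonneg ((m.idm p).2.1 b)
    (Finset.sum_nonneg fun i _ => sq_nonneg _)) (mul_nonneg hβ.le (Finset.sum_nonneg fun b _ => ?_))
  exact Real.negMulLog_nonneg ((m.idm p).2.1 b) (stdSimplex_apply_le_one _ b)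

/-- If the loss vanishes, then so does the entropy, so that the inverse model is deterministic, and
its label reconstructs the next state. -/
theorem exists_label_of_loss_eq_zero (hβ : 0 < β) {p : SubLatent d' S × SubLatent d' S}
    (h : m.loss β p = 0) : ∃ b, (m.idm p : B → ℝ) b = 1 ∧ m.fdm b p.1 = p.2 := by
  have hq0 : ∀ b, 0 ≤ (m.idm p : B → ℝ) b := (m.idm p).2.1
  have hq1 : ∀ b, (m.idm p : B → ℝ) b ≤ 1 := stdSimplex_apply_le_one _
  have hrec : ∀ b, 0 ≤ (m.idm p : B → ℝ) b * ∑ i, ‖p.2 i - m.fdm b p.1 i‖ ^ 2 := fun b =>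
    mul_nonneg (hq0 b) (Finset.sum_nonneg fun i _ => sq_nonneg _)
  have hent : ∀ b, 0 ≤ Real.negMulLog ((m.idm p : B → ℝ) b) := fun b =>
    Real.negMulLog_nonneg (hq0 b) (hq1 b)
  obtain ⟨h₁, h₂⟩ := (add_eq_zero_iff_of_nonneg (Finset.sum_nonneg fun b _ => hrec b)
    (mul_nonneg hβ.le (Finset.sum_nonneg fun b _ => hent b))).1 h
  rw [Finset.sum_eq_zero_iff_of_nonneg fun b _ => hrec b] at h₁
  rw [mul_eq_zero, or_iff_right hβ.ne', Finset.sum_eq_zero_iff_of_nonneg fun b _ => hent b] at h₂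
  obtain ⟨b, hb⟩ : ∃ b, (m.idm p : B → ℝ) b ≠ 0 := by
    by_contra! hall
    have : ∑ b, (m.idm p : B → ℝ) b = 1 := (m.idm p).2.2
    simp [hall] at this
  have hb1 : (m.idm p : B → ℝ) b = 1 := by
    have := h₂ b (Finset.mem_univ b)
    rw [Real.negMulLog, mul_eq_zero, neg_eq_zero, or_iff_right hb] at this
    exact Real.eq_one_of_pos_of_log_eq_zero ((hq0 b).lt_of_ne' hb) this
  refine ⟨b, hb1, ?_⟩
  have := h₁ b (Finset.mem_univ b)
  rw [hb1, one_mul, Finset.sum_eq_zero_iff_of_nonneg fun i _ => sq_nonneg _] at this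
  funext i
  have := this i (Finset.mem_univ i)
  rw [sq_eq_zero_iff, norm_eq_zero, sub_eq_zero] at this
  exact this.symm

end LatentActionModel

/-- For every injective relabeling of the actions, some latent action model labels the transitions
accordingly and reconstructs them. -/
theorem IsIdentifiableEncoding.exists_model [Finite A] (H : IsIdentifiableEncoding M M' P S K F)
    {B : Type*} [Fintype B] [Nonempty A] {v : A → B} (hv : Function.Injective v) (β : ℝ) :
    ∃ m : LatentActionModel d' S B,
      ∫⁻ p, ENNReal.ofReal (m.loss β (encodedTransition M M' S p)) ∂P = 0 := by
  have : Nonempty B := Nonempty.map v ‹Nonempty A›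
  obtain ⟨q, hq⟩ := H.exists_classifier v
  refine ⟨⟨q, fun b => F (Function.invFun v b)⟩, ?_⟩
  rw [lintegral_congr_ae (g := 0) ?_]
  · simp
  filter_upwards [H.ae_mem] with p ⟨w, hw, hp⟩
  rw [hp, LatentActionModel.loss_eq_zero _ β (b := v p.2) (hq _ w hw)]
  · simp
  · simp [Function.leftInverse_invFun hv p.2]

theorem IsIdentifiableEncoding.exists_isReconstructionSolution [TopologicalSpace A] [Finite A]
    [Nonempty A] (H : IsIdentifiableEncoding M M' P S K F) {B : Type*} [Fintype B] {v : A → B}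
    (hv : Function.Injective v) (β : ℝ) :
    ∃ m : LatentActionModel d' S B, IsReconstructionSolution M M' P S β m := by
  obtain ⟨m, hm⟩ := H.exists_model hv β
  exact ⟨m, fun m₁ => hm.trans_le bot_le⟩

/-- A solution of the reconstruction problem labels every transition on the support
deterministically, through an injective relabeling of the actions. The label of `(w, F a w)` does
not depend on `w` because `K a` is connected, and two actions cannot share a label because at a
common starting point the label determines the next state. -/
theorem IsIdentifiableEncoding.reconstructionSolution_apply [TopologicalSpace A] [Fintype A]
    [Nonempty A] (H : IsIdentifiableEncoding M M' P S K F) {B : Type*} [Fintype B]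
    (hcard : Fintype.card A ≤ Fintype.card B) {β : ℝ} (hβ : 0 < β) {m : LatentActionModel d' S B}
    (hm : IsReconstructionSolution M M' P S β m) :
    ∃ v : A → B, Function.Injective v ∧
      ∀ a, ∀ w ∈ K a, (m.idm (w, F a w) : B → ℝ) (v a) = 1 := by
  obtain ⟨v₀⟩ := Function.Embedding.nonempty_of_card_le hcard
  obtain ⟨m₀, hm₀⟩ := H.exists_model v₀.injective β
  have h0 := le_bot_iff.1 ((hm m₀).trans_eq hm₀)
  have hmeas : AEMeasurable
      (fun p => ENNReal.ofReal (m.loss β (encodedTransition M M' S p))) P :=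
    (ENNReal.continuous_ofReal.comp
      (m.continuous_loss β)).measurable.comp_aemeasurable H.aemeasurable
  rw [bot_eq_zero, lintegral_eq_zero_iff' hmeas] at h0
  have hzero : ∀ a, ∀ w ∈ K a, m.loss β (w, F a w) = 0 := by
    refine H.extend (fun _ => {x | m.loss β x = 0})
      (fun _ => isClosed_eq (m.continuous_loss β) continuous_const) ?_
    filter_upwards [h0] with p hp
    exact le_antisymm (ENNReal.ofReal_eq_zero.1 hp) (m.loss_nonneg hβ _)
  have hlabel : ∀ a, ∀ w ∈ K a, ∃ b, (m.idm (w, F a w) : B → ℝ) b = 1 ∧ m.fdm b w = F a w :=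
    fun a w hw => m.exists_label_of_loss_eq_zero hβ (hzero a w hw)
  -- the label is the same for all transitions of an action
  have hconst : ∀ a, ∃ b, ∀ w ∈ K a, (m.idm (w, F a w) : B → ℝ) b = 1 ∧ m.fdm b w = F a w := by
    intro a
    rcases (K a).eq_empty_or_nonempty with hK | ⟨w₀, hw₀⟩
    · exact ⟨v₀ a, by simp [hK]⟩
    obtain ⟨b, hb, -⟩ := hlabel a w₀ hw₀
    have hcont : Continuous fun w => (m.idm (w, F a w) : B → ℝ) b :=
      (continuous_apply b).comp (continuous_subtype_val.comp
        (m.idm.continuous.comp (continuous_id.prodMk (F a).continuous)))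
    have hmaps : MapsTo (fun w => (m.idm (w, F a w) : B → ℝ) b) (K a) {0, 1} := by
      intro w hw
      obtain ⟨b', hb', -⟩ := hlabel a w hw
      by_cases h : b = b'
      · exact Or.inr (h ▸ hb')
      · exact Or.inl (stdSimplex_apply_eq_zero hb' h)
    refine ⟨b, fun w hw => ?_⟩
    have hb1 : (m.idm (w, F a w) : B → ℝ) b = 1 :=
      ((H.isPreconnected a).constant_of_mapsTo (Set.toFinite {0, 1}).isDiscrete
        hcont.continuousOn hmaps hw hw₀).trans hb
    obtain ⟨b', hb', hf⟩ := hlabel a w hw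
    have : b' = b := by
      by_contra h
      rw [stdSimplex_apply_eq_zero hb1 h] at hb'
      exact zero_ne_one hb'
    exact ⟨hb1, this ▸ hf⟩
  choose u hu using hconst
  obtain ⟨v, hv, hvu⟩ := exists_injective_extension hcard {a | (K a).Nonempty} u (by
    intro a ha b hb hab
    obtain ⟨w, hwa, hwb⟩ := H.overlap a b ha hb
    refine H.injective w a b hwa hwb ?_
    rw [← (hu a w hwa).2, ← (hu b w hwb).2, hab])
  refine ⟨v, hv, fun a w hw => ?_⟩
  rw [hvu ⟨w, hw⟩]
  exact (hu a w hw).1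

end Identifiable

/-! ### Supports of the seed law -/

section SeedSupport

variable {k n : ℕ} {d d' : Fin k → ℕ} {A : Type*} [MeasurableSpace A]

theorem measurable_restrict_prod (S : Finset (Fin k)) :
    Measurable fun p : Latent d × A => (S.restrict p.1, p.2) :=
  ((Finset.measurable_restrict S).comp measurable_fst).prodMk measurable_snd

variable [TopologicalSpace A]

theorem isClosed_slice (P : Measure (Latent d × A)) (S : Finset (Fin k)) (a : A) :
    IsClosed {w | (w, a) ∈ marginalSupport P S} :=
  Measure.isClosed_support.preimage (Continuous.prodMk_left a)

variable [DiscreteTopology A]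

theorem measure_action_pos [MeasurableSingletonClass A] {P : Measure (Latent d × A)} {a : A}
    (h : a ∈ actionSupport P) :
    0 < P {p | p.2 = a} := by
  rw [actionSupport, Measure.support_eq_forall_isOpen] at h
  have := h {a} rfl (isOpen_discrete _)
  rwa [Measure.map_apply measurable_snd (measurableSet_singleton a)] at this

variable [Finite A]

theorem ae_onSubsetSupport (P : Measure (Latent d × A)) (S : Finset (Fin k)) :
    ∀ᵐ p ∂P, OnSubsetSupport P S p.1 p.2 :=
  ae_of_ae_map (measurable_restrict_prod S).aemeasurable Measure.support_mem_ae

variable [MeasurableSingletonClass A]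

theorem mem_actionSupport {P : Measure (Latent d × A)} {S : Finset (Fin k)} {w : SubLatent d S}
    {a : A} (h : (w, a) ∈ marginalSupport P S) : a ∈ actionSupport P := by
  rw [marginalSupport, Measure.support_eq_forall_isOpen] at h
  rw [actionSupport, Measure.support_eq_forall_isOpen]
  intro U ha hU
  have := h (univ ×ˢ U) ⟨mem_univ _, ha⟩ (isOpen_univ.prod hU)
  rw [Measure.map_apply (measurable_restrict_prod S) (isOpen_univ.prod hU).measurableSet] at this
  rw [Measure.map_apply measurable_snd hU.measurableSet]
  refine this.trans_le (measure_mono fun p hp => hp.2)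

/-- Actions being discrete, the support of the conditional law of `z_S` given `a` is the slice at
`a` of the support of the law of `(z_S, a)`. -/
theorem mem_condSupport_iff {P : Measure (Latent d × A)} [IsFiniteMeasure P]
    {S : Finset (Fin k)} {w : SubLatent d S} {a : A} :
    w ∈ condSupport P S a ↔ (w, a) ∈ marginalSupport P S := by
  have hmeas : Measurable fun p : Latent d × A => S.restrict p.1 :=
    (Finset.measurable_restrict S).comp measurable_fst
  have hpos : ∀ U : Set (SubLatent d S), IsOpen U →
      (0 < ((ProbabilityTheory.cond P {p | p.2 = a}).map fun p => S.restrict p.1) U ↔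
        0 < (P.map fun p => (S.restrict p.1, p.2)) (U ×ˢ {a})) := by
    intro U hU
    rw [Measure.map_apply hmeas hU.measurableSet,
      Measure.map_apply (measurable_restrict_prod S) (hU.prod (isOpen_discrete _)).measurableSet,
      ProbabilityTheory.cond_apply
        (measurableSet_eq_fun measurable_snd measurable_const :
          MeasurableSet {p : Latent d × A | p.2 = a}),
      ENNReal.mul_pos_iff, and_iff_right (ENNReal.inv_pos.2 (measure_ne_top _ _))]
    convert Iff.rfl using 3
    ext p
    exact and_comm
  rw [condSupport, marginalSupport, Measure.support_eq_forall_isOpen,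
    Measure.support_eq_forall_isOpen]
  refine ⟨fun h V hV hVo => ?_, fun h U hU hUo => ?_⟩
  · have hUo : IsOpen ((fun w => (w, a)) ⁻¹' V) := hVo.preimage (Continuous.prodMk_left a)
    refine ((hpos _ hUo).1 (h _ hV hUo)).trans_le (measure_mono ?_)
    rintro ⟨w', a'⟩ ⟨hw', ha'⟩
    rw [mem_singleton_iff] at ha'
    subst ha'
    exact hw'
  · exact (hpos U hUo).2 (h _ ⟨hU, rfl⟩ (hUo.prod (isOpen_discrete _)))

/-- The conditions on the subset dynamics, transported along a homeomorphism `e` between the true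
and the learned sub-vectors on the verification subset, make the encoded transitions
identifiable. The continuous maps are Tietze extensions of the subset dynamics. -/
theorem SubsetActionConditions.exists_isIdentifiableEncoding {M : TLCM k d A n}
    {M' : TLCM k d' A n} {P : Measure (Latent d × A)} [IsFiniteMeasure P] {S S' : Finset (Fin k)}
    (hauto : M.IsAutonomous S) (hact : SubsetActionConditions M P S)
    (e : SubLatent d S ≃ₜ SubLatent d' S')
    (he : ∀ z, S'.restrict (M'.encode (M.φ z)) = e (S.restrict z)) :
    ∃ F : A → C(SubLatent d' S', SubLatent d' S'),
      IsIdentifiableEncoding M M' P S' (fun a => {w | (e.symm w, a) ∈ marginalSupport P S}) F ∧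
      ∀ z a, OnSubsetSupport P S z a →
        encodedTransition M M' S' (z, a) = (e (S.restrict z), F a (e (S.restrict z))) := by
  have hext : ∀ a, ∃ G : C(SubLatent d S, SubLatent d S),
      ∀ w, (w, a) ∈ marginalSupport P S → G w = M.subsetDynamics S w a := by
    intro a
    obtain ⟨G, hG⟩ := ContinuousMap.exists_restrict_eq (isClosed_slice P S a)
      ⟨_, (hact.continuity a).domRestrict⟩
    exact ⟨G, fun w hw => DFunLike.congr_fun hG ⟨w, hw⟩⟩
  choose G hG using hext
  let F : A → C(SubLatent d' S', SubLatent d' S') := fun a =>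
    ⟨fun w => e (G a (e.symm w)), e.continuous.comp ((G a).continuous.comp e.symm.continuous)⟩
  have hF : ∀ a w, F a (e w) = e (G a w) := fun a w => by simp [F]
  have htr : ∀ z a, OnSubsetSupport P S z a →
      encodedTransition M M' S' (z, a) = (e (S.restrict z), F a (e (S.restrict z))) := by
    intro z a h
    rw [hF, hG a _ h, hauto.subsetDynamics_restrict, ← he, ← he]
    rfl
  have hslice : ∀ a, {w | (e.symm w, a) ∈ marginalSupport P S} = e '' condSupport P S a := by
    intro a
    rw [e.image_eq_preimage_symm]
    ext w
    exact mem_condSupport_iff.symm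
  refine ⟨F, ⟨fun a => ?_, fun a => ?_, fun a b ha hb => ?_, fun w a b ha hb hab => ?_, ?_, ?_,
    fun C hC hP a w hw => ?_⟩, htr⟩
  · exact (isClosed_slice P S a).preimage e.symm.continuous
  · rcases Set.eq_empty_or_nonempty {w | (e.symm w, a) ∈ marginalSupport P S} with h | ⟨w, hw⟩
    · simpa only [h] using isPreconnected_empty
    · rw [hslice]
      exact (hact.connected a (mem_actionSupport hw)).isPreconnected.image _
        e.continuous.continuousOn
  · obtain ⟨w, hwa, hwb⟩ :=
      hact.overlap a (mem_actionSupport ha.some_mem) b (mem_actionSupport hb.some_mem)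
    exact ⟨e w, by simpa using mem_condSupport_iff.1 hwa, by simpa using mem_condSupport_iff.1 hwb⟩
  · refine hact.injectivity (e.symm w) a b ha hb ?_
    rw [← hG a _ ha, ← hG b _ hb]
    exact e.injective hab
  · -- the transition map itself need not be measurable, but it agrees almost surely with a
    -- continuous map
    have hmeas : Measurable fun p : Latent d × A => (e (S.restrict p.1), p.2) :=
      (e.continuous.measurable.comp
        ((Finset.measurable_restrict S).comp measurable_fst)).prodMk measurable_snd
    have hpair : Measurable fun x : SubLatent d' S' × A => (x.1, F x.2 x.1) :=
      measurable_fst.prodMk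
        (measurable_from_prod_countable_left fun a => (F a).continuous.measurable)
    refine ⟨_, hpair.comp hmeas, ?_⟩
    filter_upwards [ae_onSubsetSupport P S] with p hp using htr p.1 p.2 hp
  · filter_upwards [ae_onSubsetSupport P S] with p hp
    refine ⟨e (S.restrict p.1), ?_, htr p.1 p.2 hp⟩
    rwa [e.symm_apply_apply]
  · let D : Set (SubLatent d S × A) := {x | (e x.1, F x.2 (e x.1)) ∈ C x.2}
    have hD : IsClosed D := by
      have : D = ⋃ a, ((fun w => (e w, F a (e w))) ⁻¹' C a) ×ˢ {a} := by
        ext ⟨w, a⟩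
        simp [D]
      rw [this]
      exact isClosed_iUnion_of_finite fun a => ((hC a).preimage
        (e.continuous.prodMk ((F a).continuous.comp e.continuous))).prod (isClosed_discrete _)
    have hDP : D ∈ ae (P.map fun p : Latent d × A => (S.restrict p.1, p.2)) := by
      refine (ae_map_iff (measurable_restrict_prod S).aemeasurable hD.measurableSet).2 ?_
      filter_upwards [ae_onSubsetSupport P S, hP] with p hp hp'
      rwa [htr p.1 p.2 hp] at hp'
    have := Measure.support_subset_of_isClosed hD hDP hw
    simpa [D] using this

end SeedSupport

/-! ### Labeling of transitions beyond the seed support -/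

theorem mainTheorem2 {k n : ℕ} {d d' : Fin k → ℕ} {A : Type*} [Fintype A] [TopologicalSpace A]
    [DiscreteTopology A] [MeasurableSpace A] [MeasurableSingletonClass A]
    -- the true model, the learned model, and the seed law of `(z, a)`
    (M : TLCM k d A n) (M' : TLCM k d' A n) (P : Measure (Latent d × A)) [IsProbabilityMeasure P]
    -- identifiability of the latent blocks
    (σ : Equiv.Perm (Fin k)) (hcons : M.IsConsistent M' P σ) (hgraph : M.GraphicalCriterion)
    -- the verification subset `S`, in the true model and (`S'`) in the learned model
    (T S S' : Finset (Fin k)) (hT : M.IsInsulated T) (hS : S = M.verificationSubset T)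
    (hS' : S' = M'.verificationSubset (T.map σ.toEmbedding)) (hauto : M.IsAutonomous S)
    -- identifiability of the action from subset transitions
    (hact : SubsetActionConditions M P S) :
    -- the learned blocks are the true ones up to a permutation and block-wise invertible maps,
    -- and the verification subset is relabeled accordingly
    (∃ c : ∀ i, EuclideanSpace ℝ (Fin (d' (σ i))) ≃ₜ EuclideanSpace ℝ (Fin (d i)),
      ∀ x ∈ Set.range M.φ, ∀ i, M.encode x i = c i (M'.encode x (σ i))) ∧
    M'.IsInsulated (T.map σ.toEmbedding) ∧ S' = S.map σ.toEmbedding ∧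
    -- the missing label is determined by the subset transition
    (∀ (z : Latent d) (a : A), OnSubsetSupport P S z a →
      ∃! a₁, OnSubsetSupport P S z a₁ ∧
        M.subsetDynamics S (S.restrict z) a₁ = S.restrict (M.g z a)) ∧
    -- solutions of the latent-action reconstruction problem exist, recover the action up to a fixed
    -- relabeling `v`, and admit decoders that fit the labeled seed data
    (∀ (N : ℕ) (β : ℝ), Fintype.card A ≤ N → 0 < β →
      (∃ m : LatentActionModel d' S' (Fin N), IsReconstructionSolution M M' P S' β m) ∧
      ∀ m : LatentActionModel d' S' (Fin N), IsReconstructionSolution M M' P S' β m →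
        (∃ v : A → Fin N, Function.Injective v ∧
          (Fintype.card A = N → Function.Bijective v) ∧
          ∀ (z : Latent d) (a : A), OnSubsetSupport P S z a →
            (m.idm (M'.encodePair S' (M.φ z) (M.φ (M.g z a))) : Fin N → ℝ) (v a) = 1 ∧
            predictedLabel (m.idm (M'.encodePair S' (M.φ z) (M.φ (M.g z a)))) = v a) ∧
        ∃ r, IsLabelDecoder M M' P S' m r) ∧
    -- solutions of the supervised problem exist
    (∃ q, IsSupervisedSolution M M' P S' q) ∧
    -- every trained inverse model labels correctly all transitions that satisfy the
    -- generation-verification gap, and thereby enlarges the labeled support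
    ∀ h, IsTrainedInverseModel M M' P S' h →
      (∀ (z : Latent d) (a : A), OnSubsetSupport P S z a →
        ∀ x x', x = M.φ z → x' = M.φ (M.g z a) →
          h (M'.encodePair S' x x') = a ∧ x' = M.φ (M.g z (h (M'.encodePair S' x x'))) ∧
          ((z, a) ∉ P.support → IsCompositionalOOS P z a ∧
            P.support ⊂ P.support ∪ {(z, h (M'.encodePair S' x x'))})) ∧
      ∀ (Ptest : Measure (Latent d × A)), IsProbabilityMeasure Ptest →
        (∀ᵐ p ∂Ptest, OnSubsetSupport P S p.1 p.2) →
        ∀ Q : Measure (Latent d × A),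
          Q = Ptest.map (fun p => (p.1, h (encodedTransition M M' S' p))) →
          Q = Ptest ∧ (P + Q).support = P.support ∪ Ptest.support ∧
            (0 < Ptest P.supportᶜ → P.support ⊂ (P + Q).support) := by
  subst hS
  obtain ⟨c, hc⟩ := hcons.exists_blockwise hgraph
  have hS'eq := hS'.trans (hcons.verificationSubset_map T)
  generalize M.verificationSubset T = S at *
  subst hS'eq
  obtain ⟨e, he⟩ := TLCM.exists_subLatent_homeomorph c hc S
  obtain ⟨F, H, htr⟩ := hact.exists_isIdentifiableEncoding hauto e he
  have : Nonempty A := P.nonempty_of_neZero.map Prod.snd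
  have hK : ∀ z a, OnSubsetSupport P S z a →
      (e.symm (e (S.restrict z)), a) ∈ marginalSupport P S := fun z a h => by
    rwa [e.symm_apply_apply]
  -- a solution of the reconstruction problem relabels all transitions with the gap
  have hrec : ∀ (N : ℕ) (β : ℝ), Fintype.card A ≤ N → 0 < β →
      ∀ m : LatentActionModel d' (S.map σ.toEmbedding) (Fin N),
        IsReconstructionSolution M M' P (S.map σ.toEmbedding) β m →
        ∃ v : A → Fin N, Function.Injective v ∧ ∀ z a, OnSubsetSupport P S z a →
          (m.idm (encodedTransition M M' (S.map σ.toEmbedding) (z, a)) : Fin N → ℝ) (v a) = 1 := by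
    intro N β hN hβ m hm
    obtain ⟨v, hv, hmv⟩ := H.reconstructionSolution_apply (by simpa using hN) hβ hm
    refine ⟨v, hv, fun z a h => ?_⟩
    rw [htr z a h]
    exact hmv a _ (hK z a h)
  refine ⟨⟨c, hc⟩, hcons.isInsulated_map hT, rfl, ?_, ?_, H.exists_isSupervisedSolution, ?_⟩
  · refine fun z a h => ⟨a, ⟨h, hauto.subsetDynamics_restrict z a⟩, fun b hb => ?_⟩
    exact hact.injectivity _ b a hb.1 h (hb.2.trans (hauto.subsetDynamics_restrict z a).symm)
  · intro N β hN hβ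
    obtain ⟨v₀⟩ := Function.Embedding.nonempty_of_card_le
      (hN.trans_eq (Fintype.card_fin N).symm)
    refine ⟨H.exists_isReconstructionSolution v₀.injective β, fun m hm => ?_⟩
    obtain ⟨v, hv, hmv⟩ := hrec N β hN hβ m hm
    refine ⟨⟨v, hv, fun hcard => ?_, fun z a h => ⟨hmv z a h, predictedLabel_eq (hmv z a h)⟩⟩,
      Function.invFun v, ?_⟩
    · exact (Fintype.bijective_iff_injective_and_card v).2 ⟨hv, by simpa using hcard⟩
    · filter_upwards [ae_onSubsetSupport P S] with p hp
      rw [predictedLabel_eq (hmv p.1 p.2 hp)]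
      exact Function.leftInverse_invFun hv p.2
  intro h hh
  have hlabel : ∀ z a, OnSubsetSupport P S z a →
      h (encodedTransition M M' (S.map σ.toEmbedding) (z, a)) = a := by
    rcases hh with ⟨q, hq, hhq⟩ | ⟨N, β, m, r, hN, hβ, hm, hr, hhm⟩
    · intro z a hza
      rw [hhq, htr z a hza]
      exact predictedLabel_eq (H.supervisedSolution_apply hq a _ (hK z a hza))
    · obtain ⟨v, hv, hmv⟩ := hrec N β hN hβ m hm
      intro z a hza
      rw [hhm, predictedLabel_eq (hmv z a hza)]
      -- `a` has positive probability, so the decoder is correct at some seed transition with label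
      -- `v a`
      obtain ⟨p, hpa, hp, hrp⟩ := ((frequently_ae_mem_iff.2
        (measure_action_pos (mem_actionSupport hza)).ne').and_eventually
          ((ae_onSubsetSupport P S).and hr)).exists
      rw [predictedLabel_eq (hmv p.1 p.2 hp), show p.2 = a from hpa] at hrp
      exact hrp
  refine ⟨?_, ?_⟩
  · rintro z a hza x x' rfl rfl
    have hl : h (M'.encodePair (S.map σ.toEmbedding) (M.φ z) (M.φ (M.g z a))) = a :=
      hlabel z a hza
    rw [hl]
    refine ⟨rfl, rfl, fun hout => ⟨⟨hout, S, hza⟩, ?_⟩⟩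
    exact ssubset_iff_insert.2 ⟨_, hout, by simp⟩
  · rintro Ptest hPtest hgap Q rfl
    have hQ : Ptest.map (fun p => (p.1, h (encodedTransition M M' (S.map σ.toEmbedding) p))) =
        Ptest := by
      rw [Measure.map_congr (g := id) ?_, Measure.map_id]
      filter_upwards [hgap] with p hp
      rw [hlabel p.1 p.2 hp]
      rfl
    rw [hQ, Measure.support_add]
    refine ⟨rfl, rfl, fun hpos => ?_⟩
    rw [ssubset_union_left_iff]
    intro hsub
    refine hpos.ne' (measure_mono_null (compl_subset_compl.2 hsub) ?_)
    exact Measure.measure_compl_support
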